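/- **Theorem (Hubs Lower Bound).** For a finite graph $G$ let $T(G)$ be its number of triangles. For $r,d\ge 1$, let $H_{r,d}$ be the graph consisting of $r$ vertex-disjoint copies of the following graph: a single (hub) vertex lying in $d$ edge-disjoint triangles (so each copy has $2d+1$ vertices and $d$ triangles, any two of which meet only in the hub). In the insertion-only streaming model, the edges of a graph with vertex labels in a set $W$ arrive one after the other, each exactly once and in adversarial order. A randomized one-pass algorithm using $S$ bits updates a memory of $S$ bits at each edge, and finally returns a real number computed from its memory; its random bits are not charged as memory. For $\epsilon,\delta>0$, the algorithm *solves* $G$ with $(\epsilon,\delta)$ error if, for every graph $G'$ with vertex labels in $W$ that is isomorphic to a (not necessarily induced) subgraph of $G$, and for every order of arrival of the edges of $G'$, it returns a number within $\epsilon\,T(G)$ of $T(G')$ with probability at least $1-\delta$. Let $\mathrm{InstOpt}(G,\epsilon,\delta)$ be the least $S$ such that some algorithm using $S$ bits solves $G$ with $(\epsilon,\delta)$ error ($\infty$ if there is none). Then for every constant $\delta\in(0,1)$ there are $\epsilon_0>0$, $c>0$ and $d_0$, depending only on $\delta$, such that for all $0<\epsilon\le\epsilon_0$, all $r\ge 1$,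 all $d\ge d_0$ and every set $W$ of labels with at least as many elements as $H_{r,d}$ has vertices, $$\mathrm{InstOpt}(H_{r,d},\epsilon,\delta)\ \ge\ c\sqrt d .$$ That is, for sufficiently small constant $\epsilon$, $\mathrm{InstOpt}(H_{r,d},\epsilon,\delta)=\Omega(\sqrt d)$ bits in the insertion-only model. -/

import Mathlib

universe u v

/-- The number of triangles `T(G)` of a graph. -/
noncomputable def triangleCount {V : Type u} (G : SimpleGraph V) : ℕ :=
  (G.cliqueSet 3).ncard

/-- The hubs graph `H_{r,d}`: `r` disjoint copies of a hub vertex lying in `d` edge-disjoint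
triangles.  In copy `i`, the vertex `(i, none)` is the hub, and the `j`-th triangle at this hub has
the two further vertices `(i, some (j, false))` and `(i, some (j, true))`. -/
def hubsGraph (r d : ℕ) : SimpleGraph (Fin r × Option (Fin d × Bool)) where
  Adj x y := x.1 = y.1 ∧ x.2 ≠ y.2 ∧
    (x.2 = none ∨ y.2 = none ∨ x.2.map Prod.fst = y.2.map Prod.fst)
  symm := ⟨fun _ _ h => ⟨h.1.symm, h.2.1.symm, h.2.2.elim (fun a => Or.inr (Or.inl a))
    fun b => b.elim Or.inl fun c => Or.inr (Or.inr c.symm)⟩⟩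
  loopless := ⟨fun _ h => h.2.1 rfl⟩

/-- A memory of `S` bits. -/
abbrev Memory (S : ℕ) : Type := Fin S → Bool

/-- A randomized one-pass insertion-only streaming algorithm with `S` bits of memory, for streams
of edges between vertices with labels in `W`.

Its random bits form a point `ω` of an arbitrary probability space and are not charged as memory.
The update map `step ω t` is the one used on the `t`-th edge of the stream; the dependence on `t`
lets the algorithm draw fresh randomness at each edge.  Between two edges, and before the output is
computed, all that the algorithm keeps about the stream is the content of its memory. -/
structure StreamingAlgorithm (W : Type u) (S : ℕ) where
  Ω : Type
  [measurableSpace : MeasurableSpace Ω]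
  μ : MeasureTheory.Measure Ω
  [isProbabilityMeasure : MeasureTheory.IsProbabilityMeasure μ]
  start : Ω → Memory S
  step : Ω → ℕ → Sym2 W → Memory S → Memory S
  output : Ω → Memory S → ℝ
  measurable_start : Measurable start
  measurable_step : ∀ t e s, Measurable fun ω => step ω t e s
  measurable_output : ∀ s, Measurable fun ω => output ω s

attribute [instance] StreamingAlgorithm.measurableSpace
  StreamingAlgorithm.isProbabilityMeasure

namespace StreamingAlgorithm

variable {W : Type u} {S : ℕ} (A : StreamingAlgorithm W S)

/-- The memory after the edges of a list are inserted one after the other, when the memory is `s`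
and `t` edges have been inserted before. -/
def runFrom (ω : A.Ω) : ℕ → Memory S → List (Sym2 W) → Memory S
  | _, s, [] => s
  | t, s, e :: l => runFrom ω (t + 1) (A.step ω t e s) l

/-- The number returned on the stream `l`, with randomness `ω`. -/
def result (ω : A.Ω) (l : List (Sym2 W)) : ℝ :=
  A.output ω (A.runFrom ω 0 (A.start ω) l)

/-- The algorithm solves `G` with `(ε, δ)` error: for every graph `G'` with vertex labels in `W`
that is isomorphic to a subgraph of `G`, and for every order `l` in which the edges of `G'` arrive,
it returns `T(G') ± ε T(G)` with probability at least `1 - δ`.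

A graph with vertex labels in `W` is a subgraph of the complete graph on `W`; the relation `⊑` says
that a graph is isomorphic to a (not necessarily induced) subgraph of another one. -/
def Solves {V : Type v} (G : SimpleGraph V) (ε δ : ℝ) : Prop :=
  ∀ G' : (⊤ : SimpleGraph W).Subgraph, G'.coe.IsContained G →
    ∀ l : List (Sym2 W), l.Nodup → (∀ e, e ∈ l ↔ e ∈ G'.edgeSet) →
      1 - δ ≤ A.μ.real
        {ω | |A.result ω l - (triangleCount G'.coe : ℝ)| ≤ ε * (triangleCount G : ℝ)}

end StreamingAlgorithm

/-- The instance-optimum of `G` for insertion-only streams of graphs with vertex labels in `W`: the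
least number of bits of memory with which some algorithm solves `G` with `(ε, δ)` error (it is `⊤`
if there is no such algorithm). -/
noncomputable def instOpt (W : Type u) {V : Type v} (G : SimpleGraph V) (ε δ : ℝ) : ℕ∞ :=
  sInf {m : ℕ∞ | ∃ (S : ℕ) (A : StreamingAlgorithm W S), A.Solves G ε δ ∧ m = S}

/-!
The bound comes from a one-way communication problem about hidden parities, in the style of the
Boolean hidden matching problem.

*Reduction.* The vertices of each hub other than the hub itself are split into pairs, indexed by
`v : Fin d`. The first half of the stream encodes a point `x` of the cube `{0,1}^d`: the hub is
joined to one of the two vertices of the pair `v`, chosen by the bit `x v`. The second half encodes a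
partial matching of `Fin d` and a mask `w`: for each matched `{u, v}`, the pairs over `u` and `v` are
joined by two parallel or two crossing edges, as told by the bit of `w`. This edge of the matching
produces one triangle if `x u + x v` equals its bit of `w`, and none otherwise
(`triangleCount_hardGraph`), and the whole graph embeds into `H_{r,d}` whatever `x` and `w` are
(`hardGraph_isContained`). If `w` is the vector of parities of `x` along the matching, masked by a
fixed pattern `b`, then the number of triangles is `r` times the number of zeros of `b`, exactly. All
`r` copies carry the same input, so that `r` drops out.

*Indistinguishability.* Take `K` patterns whose numbers of zeros are so far apart that the accepted
answers are pairwise disjoint. Given the memory after the first half, `x` is uniform on a set `A`,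
and `A` has density at least `2^{-D}` with `D` slightly larger than the number `S` of bits, unless
the memory content is an unlikely one. If `D²` is at most the number of matched edges, which is a
small constant fraction of `d`, then the parities of a random point of `A` along a random matching
are nearly uniform (`sum_perm_sum_abs_card_fiber_sub_le`). So the masked parities say almost nothing
about the pattern, and the success probabilities for the `K` patterns add up to little more than `1`
(`sum_card_correct_le`). They add up to at least `K (1 - δ)`, which is a contradiction when `K` is
larger than `2 / (1 - δ)`. This covers every `δ < 1`, since the number of patterns depends on `δ`.

*Fourier analysis.* The squared distance from uniformity is a sum of squared Fourier coefficients of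
`A` at unions of `k ≥ 1` edges of the matching, hence at sets of size `2k`. A given set of size `2k`
is such a union with a probability bounded in `choose_mul_pow_le_choose_two_mul`, and the total weight
of `A` at level `2k` is bounded by the level inequality `sum_charSum_sq_le`, a consequence of
`hypercontractivity` for even moments. The product of the two bounds is geometrically small in `k`.
-/

open Finset

/-! ### Characters of the Boolean cube -/

/-- The sign `±1` of a bit. -/
def bitSign (b : Bool) : ℝ := if b then -1 else 1

theorem bitSign_sq (b : Bool) : bitSign b * bitSign b = 1 := by
  cases b <;> norm_num [bitSign]

theorem bitSign_xor (a b : Bool) : bitSign (xor a b) = bitSign a * bitSign b := by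
  cases a <;> cases b <;> norm_num [bitSign]

theorem bitSign_not (b : Bool) : bitSign (!b) = -bitSign b := by
  cases b <;> norm_num [bitSign]

/-- The character `χ_S` of the cube `{0,1}^ι`. -/
def cubeChar {ι : Type*} (S : Finset ι) (x : ι → Bool) : ℝ := ∏ i ∈ S, bitSign (x i)

/-- The Fourier coefficient of the indicator function of `A` at `S`, without normalisation. -/
def charSum {ι : Type*} (A : Finset (ι → Bool)) (S : Finset ι) : ℝ := ∑ x ∈ A, cubeChar S x

theorem cubeChar_insert {ι : Type*} [DecidableEq ι] {S : Finset ι} {a : ι} (ha : a ∉ S)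
    (x : ι → Bool) : cubeChar (insert a S) x = bitSign (x a) * cubeChar S x := by
  simp [cubeChar, prod_insert ha]

theorem sum_cubeChar_mul_cubeChar {ι : Type*} [Fintype ι] [DecidableEq ι] (x y : ι → Bool) :
    ∑ S : Finset ι, cubeChar S x * cubeChar S y
      = if x = y then (2 : ℝ) ^ Fintype.card ι else 0 := by
  have h : ∑ S : Finset ι, cubeChar S x * cubeChar S y
      = ∏ i : ι, (1 + bitSign (x i) * bitSign (y i)) := by
    rw [prod_one_add, powerset_univ]
    simp [cubeChar, prod_mul_distrib]
  rw [h]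
  split_ifs with hxy
  · subst hxy
    simp only [bitSign_sq, prod_const, card_univ]
    norm_num
  · obtain ⟨i, hi⟩ := Function.ne_iff.mp hxy
    refine prod_eq_zero (mem_univ i) ?_
    cases hx : x i <;> cases hy : y i <;> simp_all [bitSign]

/-- Parseval's identity on the cube, without normalisation. -/
theorem sum_sq_sum_mul_cubeChar {ι : Type*} [Fintype ι] [DecidableEq ι] (f : (ι → Bool) → ℝ) :
    ∑ S : Finset ι, (∑ x, f x * cubeChar S x) ^ 2
      = 2 ^ Fintype.card ι * ∑ x, f x ^ 2 := by
  have h : ∀ S : Finset ι, (∑ x, f x * cubeChar S x) ^ 2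
      = ∑ x, ∑ y, f x * f y * (cubeChar S x * cubeChar S y) := by
    intro S
    rw [sq, sum_mul_sum]
    exact sum_congr rfl fun x _ => sum_congr rfl fun y _ => by ring
  simp_rw [h]
  rw [sum_comm, mul_sum]
  refine sum_congr rfl fun x _ => ?_
  rw [sum_comm]
  simp_rw [← mul_sum, sum_cubeChar_mul_cubeChar]
  simp
  ring

/-! ### Hypercontractivity for even moments -/

theorem choose_two_mul_le (j i : ℕ) (hi : i ≤ j) :
    ((2 * j).choose (2 * i) : ℝ) ≤ j.choose i * (2 * j - 1) ^ i := by
  induction i with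
  | zero => simp
  | succ i ih =>
    have ih := ih (by omega)
    have h1 : ((2 * j).choose (2 * i + 1) : ℝ) * (2 * i + 1)
        = (2 * j).choose (2 * i) * (2 * j - 2 * i) := by
      have := Nat.choose_succ_right_eq (2 * j) (2 * i)
      have h2 : ((2 * j - 2 * i : ℕ) : ℝ) = 2 * j - 2 * i := by
        rw [Nat.cast_sub (by omega)]; push_cast; ring
      rw [← h2]; exact_mod_cast this
    have h2 : ((2 * j).choose (2 * (i + 1)) : ℝ) * (2 * i + 2)
        = (2 * j).choose (2 * i + 1) * (2 * j - 2 * i - 1) := by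
      have := Nat.choose_succ_right_eq (2 * j) (2 * i + 1)
      have h2 : ((2 * j - (2 * i + 1) : ℕ) : ℝ) = 2 * j - 2 * i - 1 := by
        rw [Nat.cast_sub (by omega)]; push_cast; ring
      rw [← h2]; exact_mod_cast this
    have h3 : (j.choose (i + 1) : ℝ) * (i + 1) = j.choose i * (j - i) := by
      have := Nat.choose_succ_right_eq j i
      have h2 : ((j - i : ℕ) : ℝ) = j - i := by
        rw [Nat.cast_sub (by omega)]
      rw [← h2]; exact_mod_cast this
    have hij : (i : ℝ) + 1 ≤ j := by exact_mod_cast hi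
    have hi0 : (0 : ℝ) ≤ i := i.cast_nonneg
    have h4 : ((2 * j).choose (2 * (i + 1)) : ℝ)
        = (2 * j).choose (2 * i) * ((j - i) / (i + 1)) * ((2 * j - 2 * i - 1) / (2 * i + 1)) := by
      field_simp
      linear_combination (2 * (i : ℝ) + 1) * h2 / 2 + (2 * (j : ℝ) - 2 * i - 1) * h1 / 2
    have h5 : (j.choose (i + 1) : ℝ) = j.choose i * ((j - i) / (i + 1)) := by
      field_simp
      linear_combination h3
    rw [h4, h5]
    have h6 : (2 * (j : ℝ) - 2 * i - 1) / (2 * i + 1) ≤ 2 * j - 1 := by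
      rw [div_le_iff₀ (by positivity)]
      nlinarith
    calc _ ≤ (j.choose i * (2 * j - 1) ^ i : ℝ) * ((j - i) / (i + 1)) * (2 * j - 1) := by
          have : (0 : ℝ) ≤ j - i := by linarith
          have : (0 : ℝ) ≤ 2 * j - 1 := by linarith
          have : (0 : ℝ) ≤ 2 * j - 2 * i - 1 := by linarith
          gcongr
      _ = _ := by ring

theorem sum_range_two_mul_add_one (a : ℕ → ℝ) (j : ℕ) :
    ∑ k ∈ range (2 * j + 1), a k
      = ∑ i ∈ range (j + 1), a (2 * i) + ∑ i ∈ range j, a (2 * i + 1) := by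
  induction j with
  | zero => simp
  | succ j ih =>
    rw [show 2 * (j + 1) + 1 = 2 * j + 1 + 1 + 1 by ring, sum_range_succ, sum_range_succ, ih,
      sum_range_succ _ (j + 1), sum_range_succ (fun i => a (2 * i + 1)) j,
      show 2 * j + 1 + 1 = 2 * (j + 1) by ring]
    ring

/-- The two-point inequality, from which hypercontractivity follows by induction. -/
theorem two_point_inequality (j : ℕ) (ρ u v : ℝ) (hρ : ρ ^ 2 * (2 * j - 1) ≤ 1) (hj : 1 ≤ j) :
    (u + ρ * v) ^ (2 * j) + (u - ρ * v) ^ (2 * j) ≤ 2 * (u ^ 2 + v ^ 2) ^ j := by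
  have hj' : (0 : ℝ) ≤ 2 * j - 1 := by
    have : (1 : ℝ) ≤ j := by exact_mod_cast hj
    linarith
  rw [show u + ρ * v = ρ * v + u by ring, show u - ρ * v = -(ρ * v) + u by ring,
    show u ^ 2 + v ^ 2 = v ^ 2 + u ^ 2 by ring, add_pow, add_pow, add_pow, ← sum_add_distrib,
    sum_range_two_mul_add_one, mul_sum]
  have hodd : ∑ i ∈ range j, ((ρ * v) ^ (2 * i + 1) * u ^ (2 * j - (2 * i + 1)) *
      ((2 * j).choose (2 * i + 1) : ℝ) + (-(ρ * v)) ^ (2 * i + 1) * u ^ (2 * j - (2 * i + 1)) *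
      ((2 * j).choose (2 * i + 1) : ℝ)) = 0 := by
    refine sum_eq_zero fun i _ => ?_
    rw [Odd.neg_pow ⟨i, rfl⟩]
    ring
  rw [hodd, add_zero]
  refine sum_le_sum fun i hi => ?_
  have hij : i ≤ j := by simpa [Nat.lt_succ_iff] using hi
  rw [Even.neg_pow (even_two_mul i), ← two_mul]
  refine mul_le_mul_of_nonneg_left ?_ zero_le_two
  have e1 : u ^ (2 * j - 2 * i) = (u ^ 2) ^ (j - i) := by
    rw [← pow_mul]; congr 1; omega
  have e2 : (ρ * v) ^ (2 * i) = (ρ ^ 2) ^ i * (v ^ 2) ^ i := by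
    rw [pow_mul, mul_pow, mul_pow]
  rw [e1, e2]
  have key : (ρ ^ 2) ^ i * ((2 * j).choose (2 * i) : ℝ) ≤ j.choose i := by
    calc (ρ ^ 2) ^ i * ((2 * j).choose (2 * i) : ℝ)
        ≤ (ρ ^ 2) ^ i * (j.choose i * (2 * j - 1) ^ i) := by
          gcongr; exact choose_two_mul_le j i hij
      _ = (ρ ^ 2 * (2 * j - 1)) ^ i * j.choose i := by rw [mul_pow]; ring
      _ ≤ 1 * j.choose i := by
          gcongr
          exact pow_le_one₀ (by positivity) hρ
      _ = _ := one_mul _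
  calc _ = ((ρ ^ 2) ^ i * ((2 * j).choose (2 * i) : ℝ)) * ((v ^ 2) ^ i * (u ^ 2) ^ (j - i)) := by
        ring
    _ ≤ j.choose i * ((v ^ 2) ^ i * (u ^ 2) ^ (j - i)) := by gcongr
    _ = _ := by ring

/-- Minkowski's inequality in `L^j`, in a form without roots. -/
theorem sum_add_pow_le_of_sum_pow_le {α : Type*} (s : Finset α) (f g : α → ℝ) (j : ℕ) (hj : 1 ≤ j)
    (hf : ∀ x, 0 ≤ f x) (hg : ∀ x, 0 ≤ g x) {N G H : ℝ} (hN : 0 ≤ N) (hG : 0 ≤ G) (hH : 0 ≤ H)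
    (h1 : ∑ x ∈ s, f x ^ j ≤ N * G ^ j) (h2 : ∑ x ∈ s, g x ^ j ≤ N * H ^ j) :
    ∑ x ∈ s, (f x + g x) ^ j ≤ N * (G + H) ^ j := by
  have hj0 : j ≠ 0 := by omega
  have hj1 : (1 : ℝ) ≤ j := by exact_mod_cast hj
  have hM := Real.Lp_add_le_of_nonneg (p := j) (s := s) hj1 (fun i _ => hf i) (fun i _ => hg i)
  simp only [Real.rpow_natCast] at hM
  have aux : ∀ {a T : ℝ}, 0 ≤ a → 0 ≤ T → a ≤ N * T ^ j →
      a ^ (1 / (j : ℝ)) ≤ N ^ (1 / (j : ℝ)) * T := by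
    intro a T ha hT h
    calc a ^ (1 / (j : ℝ)) ≤ (N * T ^ j) ^ (1 / (j : ℝ)) :=
          Real.rpow_le_rpow ha h (by positivity)
      _ = _ := by
        rw [Real.mul_rpow hN (by positivity), one_div, Real.pow_rpow_inv_natCast hT hj0]
  have a1 := aux (sum_nonneg fun x _ => pow_nonneg (hf x) j) hG h1
  have a2 := aux (sum_nonneg fun x _ => pow_nonneg (hg x) j) hH h2
  have a3 : (∑ x ∈ s, (f x + g x) ^ j) ^ (1 / (j : ℝ)) ≤ N ^ (1 / (j : ℝ)) * (G + H) := by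
    linarith
  have hS : 0 ≤ ∑ x ∈ s, (f x + g x) ^ j :=
    sum_nonneg fun x _ => pow_nonneg (add_nonneg (hf x) (hg x)) j
  have a4 := pow_le_pow_left₀ (by positivity) a3 j
  rwa [one_div, Real.rpow_inv_natCast_pow hS hj0, mul_pow, Real.rpow_inv_natCast_pow hN hj0] at a4

/-- Flipping the bit at a coordinate on which `u` and `v` do not depend. -/
theorem sum_flip_eq {ι : Type*} [Fintype ι] [DecidableEq ι] (a : ι) (u v : (ι → Bool) → ℝ)
    (hu : ∀ x b, u (Function.update x a b) = u x) (hv : ∀ x b, v (Function.update x a b) = v x)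
    (ρ : ℝ) (k : ℕ) :
    ∑ x, (u x + ρ * (bitSign (x a) * v x)) ^ k
      = ∑ x, (u x - ρ * (bitSign (x a) * v x)) ^ k := by
  have hinv : Function.Involutive fun x : ι → Bool => Function.update x a (!x a) :=
    fun x => by simp
  refine Fintype.sum_equiv hinv.toPerm _ _ fun x => ?_
  simp only [Function.Involutive.coe_toPerm, hu, hv, Function.update_self, bitSign_not]
  ring_nf

/-- Hypercontractivity of the noise operator from `L²` to `L^{2j}`. The induction is on the set of
variables: the two-point inequality handles the new variable, and Minkowski's inequality merges the
two parts of the polynomial. -/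
theorem hypercontractivity {ι : Type*} [Fintype ι] [DecidableEq ι] (j : ℕ) (hj : 1 ≤ j) (ρ : ℝ)
    (hρ : ρ ^ 2 * (2 * j - 1) ≤ 1) (U : Finset ι) (c : Finset ι → ℝ) :
    ∑ x : ι → Bool, (∑ S ∈ U.powerset, ρ ^ #S * c S * cubeChar S x) ^ (2 * j)
      ≤ 2 ^ Fintype.card ι * (∑ S ∈ U.powerset, c S ^ 2) ^ j := by
  induction U using Finset.induction_on generalizing c with
  | empty => simp [cubeChar, pow_mul]
  | insert a U ha ih =>
    set u : (ι → Bool) → ℝ := fun x => ∑ S ∈ U.powerset, ρ ^ #S * c S * cubeChar S x with hu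
    set v : (ι → Bool) → ℝ := fun x => ∑ S ∈ U.powerset, ρ ^ #S * c (insert a S) * cubeChar S x
      with hv
    have hnot : ∀ S ∈ U.powerset, a ∉ S := fun S hS h => ha (mem_powerset.mp hS h)
    have hind : ∀ (c' : Finset ι → ℝ) (x : ι → Bool) (b : Bool),
        ∑ S ∈ U.powerset, ρ ^ #S * c' S * cubeChar S (Function.update x a b)
          = ∑ S ∈ U.powerset, ρ ^ #S * c' S * cubeChar S x := by
      intro c' x b
      refine sum_congr rfl fun S hS => ?_
      congr 1
      refine prod_congr rfl fun i hi => ?_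
      rw [Function.update_of_ne]
      rintro rfl
      exact hnot S hS hi
    have hdec : ∀ x, ∑ S ∈ (insert a U).powerset, ρ ^ #S * c S * cubeChar S x
        = u x + ρ * (bitSign (x a) * v x) := by
      intro x
      rw [sum_powerset_insert ha, hu, hv]
      simp only [mul_sum]
      congr 1
      refine sum_congr rfl fun S hS => ?_
      rw [cubeChar_insert (hnot S hS), card_insert_of_notMem (hnot S hS)]
      ring
    have hc : ∑ S ∈ (insert a U).powerset, c S ^ 2
        = ∑ S ∈ U.powerset, c S ^ 2 + ∑ S ∈ U.powerset, c (insert a S) ^ 2 :=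
      sum_powerset_insert ha _
    simp only [hdec, hc]
    have hflip := sum_flip_eq a u v (hind c) (hind fun S => c (insert a S)) ρ (2 * j)
    have htwo : ∑ x, (u x + ρ * (bitSign (x a) * v x)) ^ (2 * j)
        ≤ ∑ x, (u x ^ 2 + v x ^ 2) ^ j := by
      have h2 : 2 * ∑ x, (u x + ρ * (bitSign (x a) * v x)) ^ (2 * j)
          ≤ 2 * ∑ x, (u x ^ 2 + v x ^ 2) ^ j := by
        rw [two_mul]
        nth_rewrite 2 [hflip]
        rw [← sum_add_distrib, mul_sum]
        refine sum_le_sum fun x _ => ?_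
        have h := two_point_inequality j ρ (u x) (bitSign (x a) * v x) hρ hj
        rwa [mul_pow, sq (bitSign _), bitSign_sq, one_mul] at h
      linarith
    refine htwo.trans ?_
    refine sum_add_pow_le_of_sum_pow_le _ _ _ j hj (fun x => sq_nonneg _) (fun x => sq_nonneg _)
      (by positivity) (sum_nonneg fun _ _ => sq_nonneg _) (sum_nonneg fun _ _ => sq_nonneg _) ?_ ?_
    · simpa only [← pow_mul] using ih c
    · simpa only [← pow_mul] using ih fun S => c (insert a S)

/-- The level inequality: a set of density at least `2^{-D}` has little Fourier weight on the sets
of size `2k`. It is Hölder's inequality for the indicator function of `A` and the level-`2k` part of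
its Fourier expansion, whose `2j`-th moment is bounded by hypercontractivity. -/
theorem sum_charSum_sq_le {ι : Type*} [Fintype ι] [DecidableEq ι] (A : Finset (ι → Bool))
    {D j k : ℕ} (hj : 1 ≤ j) (hA : (2 : ℝ) ^ Fintype.card ι ≤ 2 ^ D * #A) (hD : D ≤ j * k) :
    ∑ S ∈ powersetCard (2 * k) (univ : Finset ι), charSum A S ^ 2
      ≤ (#A : ℝ) ^ 2 * (2 * (2 * j - 1) ^ 2) ^ k := by
  set W := ∑ S ∈ powersetCard (2 * k) (univ : Finset ι), charSum A S ^ 2 with hW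
  have hj1 : (1 : ℝ) ≤ j := by exact_mod_cast hj
  set t : ℝ := 2 * j - 1 with ht
  have ht0 : 0 < t := by rw [ht]; linarith
  set ρ : ℝ := (Real.sqrt t)⁻¹ with hρ
  have hρ2 : ρ ^ 2 * t = 1 := by
    rw [hρ, inv_pow, Real.sq_sqrt ht0.le, inv_mul_cancel₀ ht0.ne']
  have hρ0 : ρ ≠ 0 := by rw [hρ]; positivity
  have hW0 : 0 ≤ W := sum_nonneg fun _ _ => sq_nonneg _
  -- The level-`2k` part of the Fourier expansion of the indicator function of `A`.
  set P : (ι → Bool) → ℝ :=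
    fun x => ∑ S ∈ powersetCard (2 * k) (univ : Finset ι), charSum A S * cubeChar S x with hP
  have hPA : ∑ x ∈ A, P x = W := by
    rw [hP, hW, sum_comm]
    refine sum_congr rfl fun S _ => ?_
    rw [← mul_sum, sq]; rfl
  have hmom : ∑ x, P x ^ (2 * j) ≤ 2 ^ Fintype.card ι * (t ^ (2 * k) * W) ^ j := by
    have h := hypercontractivity j hj ρ hρ2.le (univ : Finset ι)
      fun S => if #S = 2 * k then (ρ ^ (2 * k))⁻¹ * charSum A S else 0
    have e1 : ∀ x, ∑ S ∈ (univ : Finset ι).powerset,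
        ρ ^ #S * (if #S = 2 * k then (ρ ^ (2 * k))⁻¹ * charSum A S else 0) * cubeChar S x
          = P x := by
      intro x
      simp only [hP]
      rw [powersetCard_eq_filter, sum_filter]
      refine sum_congr rfl fun S _ => ?_
      split_ifs with hS
      · rw [hS]; field_simp
      · simp
    have e2 : ∑ S ∈ (univ : Finset ι).powerset,
        (if #S = 2 * k then (ρ ^ (2 * k))⁻¹ * charSum A S else 0) ^ 2 = t ^ (2 * k) * W := by
      rw [hW, powersetCard_eq_filter, sum_filter, mul_sum]
      refine sum_congr rfl fun S _ => ?_
      split_ifs with hS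
      · rw [mul_pow, eq_inv_of_mul_eq_one_right hρ2]
        congr 1
        rw [inv_pow (ρ ^ 2), inv_pow (ρ ^ (2 * k)), ← pow_mul, ← pow_mul, mul_comm (2 * k)]
      · simp
    simp only [e1, e2] at h
    exact h
  have hjen : W ^ (2 * j) ≤ (#A : ℝ) ^ (2 * j - 1) * ∑ x ∈ A, P x ^ (2 * j) := by
    rw [← hPA]
    have h := pow_sum_le_card_mul_sum_pow (s := A) (f := fun x => |P x|)
      (fun x _ => abs_nonneg _) (2 * j - 1)
    rw [show 2 * j - 1 + 1 = 2 * j by omega] at h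
    simp only [(even_two_mul j).pow_abs] at h
    refine le_trans ?_ h
    rw [← (even_two_mul j).pow_abs]
    exact pow_le_pow_left₀ (abs_nonneg _) (abs_sum_le_sum_abs _ _) _
  rcases hW0.eq_or_lt with h0 | hWpos
  · rw [← h0]; positivity
  have hmain : W ^ j * W ^ j ≤ ((#A : ℝ) ^ 2 * (2 * t ^ 2) ^ k) ^ j * W ^ j := by
    calc W ^ j * W ^ j = W ^ (2 * j) := by rw [← pow_add, two_mul]
      _ ≤ (#A : ℝ) ^ (2 * j - 1) * ∑ x ∈ A, P x ^ (2 * j) := hjen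
      _ ≤ (#A : ℝ) ^ (2 * j - 1) * ∑ x, P x ^ (2 * j) := by
        gcongr
        · intro i _ _; exact (even_two_mul j).pow_nonneg _
        · exact subset_univ A
      _ ≤ (#A : ℝ) ^ (2 * j - 1) * ((2 ^ (j * k) * #A) * (t ^ (2 * k) * W) ^ j) := by
        gcongr
        refine hmom.trans ?_
        gcongr
        refine hA.trans ?_
        gcongr
        norm_num
      _ = ((#A : ℝ) ^ (2 * j - 1) * #A) * (2 ^ (j * k) * (t ^ (2 * k)) ^ j) * W ^ j := by
        rw [mul_pow]; ring
      _ = _ := by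
        rw [← pow_succ, show 2 * j - 1 + 1 = 2 * j by omega, pow_mul (#A : ℝ), mul_comm j k,
          pow_mul 2 k j, mul_pow, mul_pow, ← pow_mul t 2 k, mul_pow]
  exact (pow_le_pow_iff_left₀ hW0 (by positivity) (by omega)).mp
    (le_of_mul_le_mul_right hmain (by positivity))

/-! ### Parities along a random matching -/

/-- The parities of `x` along a matching: the `j`-th edge joins `p (j, false)` and `p (j, true)`. -/
def pairParity {κ ι : Type*} (p : κ × Bool ↪ ι) (x : ι → Bool) : κ → Bool :=
  fun j => xor (x (p (j, false))) (x (p (j, true)))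

theorem cubeChar_pairParity {κ ι : Type*} (p : κ × Bool ↪ ι) (v : Finset κ) (x : ι → Bool) :
    cubeChar v (pairParity p x) = cubeChar ((v ×ˢ univ).map p) x := by
  simp only [cubeChar, pairParity, prod_map, prod_product, Fintype.prod_bool, bitSign_xor]
  exact prod_congr rfl fun i _ => mul_comm _ _

/-- The squared distance of the distribution of the parities from the uniform one, in terms of the
Fourier coefficients of `A` at the unions of edges of the matching. -/
theorem sum_sq_card_fiber_sub {κ ι : Type*} [Fintype κ] [DecidableEq κ]
    (A : Finset (ι → Bool)) (p : κ × Bool ↪ ι) :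
    2 ^ Fintype.card κ * ∑ w : κ → Bool,
        ((#{x ∈ A | pairParity p x = w} : ℝ) - #A / 2 ^ Fintype.card κ) ^ 2
      = ∑ v ∈ univ.erase ∅, charSum A ((v ×ˢ univ).map p) ^ 2 := by
  set M : ℝ := 2 ^ Fintype.card κ with hM
  have hM0 : M ≠ 0 := by positivity
  set f : (κ → Bool) → ℝ := fun w => (#{x ∈ A | pairParity p x = w} : ℝ) with hf
  have hpush : ∀ g : (κ → Bool) → ℝ, ∑ w, f w * g w = ∑ x ∈ A, g (pairParity p x) := by
    intro g
    simp only [hf, card_filter, Nat.cast_sum, sum_mul]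
    rw [sum_comm]
    exact sum_congr rfl fun x _ => by simp
  have hP := sum_sq_sum_mul_cubeChar f
  simp only [hpush, cubeChar_pairParity] at hP
  rw [← add_sum_erase _ _ (mem_univ (∅ : Finset κ))] at hP
  have h0 : ∑ x ∈ A, cubeChar (((∅ : Finset κ) ×ˢ univ).map p) x = #A := by
    simp [cubeChar]
  have h1 : ∑ w, f w = #A := by simpa using hpush fun _ => 1
  have h2 : ∑ w : κ → Bool, (f w - #A / M) ^ 2 = ∑ w, f w ^ 2 - #A ^ 2 / M := by
    have : ∀ w, (f w - #A / M) ^ 2 = f w ^ 2 - 2 * (#A / M) * f w + (#A / M) ^ 2 :=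
      fun w => by ring
    simp only [this, sum_add_distrib, sum_sub_distrib, ← mul_sum, h1, sum_const, nsmul_eq_mul]
    have hc : ((#(univ : Finset (κ → Bool)) : ℕ) : ℝ) = M := by simp [hM]
    rw [hc]
    field_simp
    ring
  rw [h2]
  simp only [charSum]
  rw [h0] at hP
  rw [mul_sub, ← hP]
  field_simp
  ring

/-- The average over all permutations of a function of the image of `T` is its average over all sets
of the same size. -/
theorem sum_perm_map {ι : Type*} [Fintype ι] [DecidableEq ι] (g : Finset ι → ℝ) (T : Finset ι) :
    (Fintype.card ι).choose #T * ∑ σ : Equiv.Perm ι, g (T.map σ.toEmbedding)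
      = (Fintype.card ι).factorial * ∑ S ∈ powersetCard #T (univ : Finset ι), g S := by
  have h1 : ∀ T' ∈ powersetCard #T (univ : Finset ι),
      ∑ σ : Equiv.Perm ι, g (T'.map σ.toEmbedding) = ∑ σ : Equiv.Perm ι, g (T.map σ.toEmbedding) := by
    intro T' hT'
    have hc : #T = #T' := (mem_powersetCard.mp hT').2.symm
    set τ : Equiv.Perm ι := (Finset.equivOfCardEq hc).extendSubtype with hτ
    have hmap : T.map τ.toEmbedding = T' := by
      refine eq_of_subset_of_card_le (fun y hy => ?_) (by simp [hc])
      obtain ⟨x, hx, rfl⟩ := mem_map.mp hy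
      exact (Finset.equivOfCardEq hc).extendSubtype_mem x hx
    refine Fintype.sum_equiv (Equiv.mulRight τ) _ _ fun σ => ?_
    rw [← hmap, map_map]
    rfl
  have h2 : ∀ σ : Equiv.Perm ι, ∑ T' ∈ powersetCard #T (univ : Finset ι), g (T'.map σ.toEmbedding)
      = ∑ S ∈ powersetCard #T (univ : Finset ι), g S := by
    intro σ
    refine sum_bij' (fun T' _ => T'.map σ.toEmbedding) (fun T' _ => T'.map σ.symm.toEmbedding)
      (fun T' h => ?_) (fun T' h => ?_) (fun T' _ => ?_) (fun T' _ => ?_) fun _ _ => rfl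
    · simpa using h
    · simpa using h
    · ext; simp
    · ext; simp
  calc _ = ∑ T' ∈ powersetCard #T (univ : Finset ι), ∑ σ : Equiv.Perm ι,
        g (T'.map σ.toEmbedding) := by
        rw [sum_congr rfl h1, sum_const, card_powersetCard, card_univ, nsmul_eq_mul]
    _ = _ := by
        rw [sum_comm, sum_congr rfl fun σ _ => h2 σ, sum_const, card_univ, Fintype.card_perm,
          nsmul_eq_mul]

theorem choose_mul_pow_le {m M : ℕ} (h : m ≤ M) (k : ℕ) :
    m.choose k * M ^ k ≤ M.choose k * m ^ k := by
  induction k with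
  | zero => simp
  | succ k ih =>
    have h1 := Nat.choose_succ_right_eq m k
    have h2 := Nat.choose_succ_right_eq M k
    have h3 : (m - k) * M ≤ (M - k) * m := by
      rw [Nat.sub_mul, Nat.sub_mul, mul_comm M m]
      have := Nat.mul_le_mul_left k h
      omega
    refine Nat.le_of_mul_le_mul_right ?_ (show 0 < k + 1 by omega)
    calc m.choose (k + 1) * M ^ (k + 1) * (k + 1)
        = (m.choose (k + 1) * (k + 1)) * (M ^ k * M) := by ring
      _ = (m.choose k * M ^ k) * ((m - k) * M) := by rw [h1]; ring
      _ ≤ (M.choose k * m ^ k) * ((M - k) * m) := Nat.mul_le_mul ih h3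
      _ = (M.choose (k + 1) * (k + 1)) * (m ^ k * m) := by rw [h2]; ring
      _ = _ := by ring

/-- A given set of `2k` points is a union of edges of a random matching of size `m` with probability
at most `(k / (L² m))^k`. -/
theorem choose_mul_pow_le_choose_two_mul {n L m k : ℕ} (hL : 1 ≤ L) (hm : 1 ≤ m) (hk : k ≤ m)
    (hn : 2 * L * m ≤ n) : m.choose k * (L ^ 2 * m) ^ k ≤ n.choose (2 * k) * k ^ k := by
  have hmL : m ≤ L * m := Nat.le_mul_of_pos_left m hL
  have h1 : m.choose k * L ^ k ≤ (L * m).choose k := by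
    refine Nat.le_of_mul_le_mul_right ?_ (pow_pos hm k)
    calc _ = m.choose k * (L * m) ^ k := by rw [mul_pow]; ring
      _ ≤ _ := choose_mul_pow_le hmL k
  have h2 : (L * m) ^ k ≤ (L * m).choose k * k ^ k := by
    simpa using choose_mul_pow_le (hk.trans hmL) k
  have h3 : (L * m).choose k * (L * m).choose k ≤ n.choose (2 * k) := by
    calc _ ≤ (L * m + L * m).choose (2 * k) := by
          rw [Nat.add_choose_eq]
          exact single_le_sum (f := fun ij : ℕ × ℕ => (L * m).choose ij.1 * (L * m).choose ij.2)
            (fun _ _ => Nat.zero_le _) (a := (k, k)) (by simp [two_mul])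
      _ ≤ _ := Nat.choose_le_choose _ (by linarith)
  calc _ = (m.choose k * L ^ k) * (L * m) ^ k := by
        rw [mul_assoc, ← mul_pow]; congr 2; ring
    _ ≤ (L * m).choose k * ((L * m).choose k * k ^ k) := Nat.mul_le_mul h1 h2
    _ = (L * m).choose k * (L * m).choose k * k ^ k := by ring
    _ ≤ _ := Nat.mul_le_mul_right _ h3

/-- The exponent used in the level inequality at level `2k`. -/
theorem exists_moment {D m k : ℕ} (hD : D ^ 2 ≤ m) (hk : 1 ≤ k) (hkm : k ≤ m) :
    ∃ j : ℕ, 1 ≤ j ∧ D ≤ j * k ∧ (k : ℝ) * (2 * j - 1) ^ 2 ≤ 9 * m := by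
  have hkm' : (k : ℝ) ≤ m := by exact_mod_cast hkm
  have hk' : (1 : ℝ) ≤ k := by exact_mod_cast hk
  rcases le_or_gt D k with h | h
  · exact ⟨1, le_rfl, by simpa using h, by norm_num; linarith⟩
  · refine ⟨D / k + 1, Nat.le_add_left 1 _, ?_, ?_⟩
    · have := Nat.lt_div_mul_add (a := D) hk
      rw [add_mul, one_mul]
      exact this.le
    · have h1 : ((D / k : ℕ) : ℝ) * k ≤ D := by exact_mod_cast Nat.div_mul_le_self D k
      have h2 : (k : ℝ) ≤ D := by exact_mod_cast h.le
      have h3 : (D : ℝ) ^ 2 ≤ m := by exact_mod_cast hD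
      set q : ℝ := ((D / k : ℕ) : ℝ)
      have hq : 0 ≤ q := by positivity
      push_cast
      have h4 : (2 * (q + 1) - 1) * k ≤ 3 * D := by nlinarith
      have h5 : ((2 * (q + 1) - 1) * k) ^ 2 ≤ (3 * D) ^ 2 :=
        pow_le_pow_left₀ (by nlinarith) h4 2
      refine le_of_mul_le_mul_right ?_ (show (0 : ℝ) < k by linarith)
      nlinarith

/-- For a set `A` of density at least `2^{-D}`, the mean square Fourier weight on the unions of
edges of a random matching is small. -/
theorem sum_perm_sum_charSum_sq_le {κ ι : Type*} [Fintype κ] [DecidableEq κ] [Fintype ι]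
    [DecidableEq ι] (A : Finset (ι → Bool)) (e : κ × Bool ↪ ι) {D L : ℕ} (hL : 6 ≤ L)
    (hκ : 1 ≤ Fintype.card κ) (hn : 2 * L * Fintype.card κ ≤ Fintype.card ι)
    (hD : D ^ 2 ≤ Fintype.card κ) (hA : (2 : ℝ) ^ Fintype.card ι ≤ 2 ^ D * #A) :
    ∑ σ : Equiv.Perm ι, ∑ v ∈ univ.erase ∅,
        charSum A ((v ×ˢ univ).map (e.trans σ.toEmbedding)) ^ 2
      ≤ (Fintype.card ι).factorial * (#A : ℝ) ^ 2 * (36 / L ^ 2) := by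
  set m := Fintype.card κ with hm
  set n := Fintype.card ι with hn'
  have hL' : (6 : ℝ) ≤ L := by exact_mod_cast hL
  have hm0 : (0 : ℝ) < m := by exact_mod_cast hκ
  set q : ℝ := 18 / L ^ 2 with hq
  have hq0 : 0 ≤ q := by positivity
  have hq1 : q ≤ 1 / 2 := by
    rw [hq, div_le_iff₀ (by positivity)]
    nlinarith
  set B : ℝ := n.factorial * (#A : ℝ) ^ 2 with hB
  have hB0 : 0 ≤ B := by positivity
  set Q : ℕ → ℝ := fun k => ∑ S ∈ powersetCard (2 * k) (univ : Finset ι), charSum A S ^ 2 with hQ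
  have hv : ∀ v : Finset κ, ∑ σ : Equiv.Perm ι,
      charSum A ((v ×ˢ univ).map (e.trans σ.toEmbedding)) ^ 2
        = n.factorial * Q #v / n.choose (2 * #v) := by
    intro v
    have h := sum_perm_map (fun S => charSum A S ^ 2) ((v ×ˢ univ).map e)
    have hc : #((v ×ˢ (univ : Finset Bool)).map e) = 2 * #v := by simp [mul_comm]
    rw [hc] at h
    have hle : 2 * #v ≤ n := by
      have h1 : #v ≤ m := card_le_univ v
      nlinarith
    have hpos : (0 : ℝ) < n.choose (2 * #v) := by exact_mod_cast Nat.choose_pos hle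
    rw [eq_div_iff hpos.ne', mul_comm]
    simpa only [map_map] using h
  have hterm : ∀ k, 1 ≤ k → k ≤ m →
      (m.choose k : ℝ) * (n.factorial * Q k / n.choose (2 * k)) ≤ B * q ^ k := by
    intro k hk1 hkm
    obtain ⟨j, hj1, hjD, hj⟩ := exists_moment hD hk1 hkm
    have h1 : Q k ≤ (#A : ℝ) ^ 2 * (2 * (2 * j - 1) ^ 2) ^ k := sum_charSum_sq_le A hj1 hA hjD
    have h2 : (m.choose k : ℝ) * (L ^ 2 * m) ^ k ≤ n.choose (2 * k) * (k : ℝ) ^ k := by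
      exact_mod_cast choose_mul_pow_le_choose_two_mul (n := n) (by omega : 1 ≤ L) hκ hkm hn
    have hle : 2 * k ≤ n := by nlinarith
    have hpos : (0 : ℝ) < n.choose (2 * k) := by exact_mod_cast Nat.choose_pos hle
    have hLm : (0 : ℝ) < (L ^ 2 * m) ^ k := by positivity
    have h3 : (m.choose k : ℝ) / n.choose (2 * k) ≤ (k : ℝ) ^ k / (L ^ 2 * m) ^ k := by
      rw [div_le_div_iff₀ hpos hLm, mul_comm ((k : ℝ) ^ k)]
      exact h2
    calc (m.choose k : ℝ) * (n.factorial * Q k / n.choose (2 * k))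
        = n.factorial * Q k * ((m.choose k : ℝ) / n.choose (2 * k)) := by ring
      _ ≤ n.factorial * ((#A : ℝ) ^ 2 * (2 * (2 * j - 1) ^ 2) ^ k)
          * ((k : ℝ) ^ k / (L ^ 2 * m) ^ k) := by gcongr
      _ = B * (2 * (k * (2 * j - 1) ^ 2) / (L ^ 2 * m)) ^ k := by
          rw [div_pow, hB, mul_pow 2, mul_pow 2, mul_pow (k : ℝ)]
          ring
      _ ≤ B * q ^ k := by
          gcongr
          rw [hq, div_le_div_iff₀ (by positivity) (by positivity)]
          nlinarith [sq_nonneg (L : ℝ)]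
  rw [sum_comm]
  simp only [hv]
  have hsum : ∑ v ∈ univ.erase (∅ : Finset κ), n.factorial * Q #v / n.choose (2 * #v)
      = ∑ k ∈ range m, ((m.choose (k + 1) : ℝ)
          * (n.factorial * Q (k + 1) / n.choose (2 * (k + 1)))) := by
    have h := sum_powerset_apply_card (fun k => (n.factorial * Q k / n.choose (2 * k) : ℝ))
      (x := (univ : Finset κ))
    rw [card_univ, ← hm, sum_range_succ', powerset_univ,
      ← add_sum_erase _ _ (mem_univ (∅ : Finset κ))] at h
    simp only [nsmul_eq_mul] at h
    simp only [card_empty, Nat.choose_zero_right, Nat.cast_one, one_mul] at h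
    linarith
  rw [hsum]
  calc _ ≤ ∑ k ∈ range m, B * (q * (1 / 2) ^ k) := by
        refine sum_le_sum fun k hk => ?_
        refine (hterm (k + 1) (by omega) (by have := mem_range.mp hk; omega)).trans ?_
        rw [pow_succ, mul_comm (q ^ k)]
        gcongr
    _ = B * q * ∑ k ∈ range m, (1 / 2 : ℝ) ^ k := by
        rw [mul_sum]
        exact sum_congr rfl fun k _ => by ring
    _ ≤ B * q * 2 := by
        gcongr
        exact sum_geometric_two_le m
    _ = _ := by rw [hq]; ring

/-- For a set `A` of density at least `2^{-D}` with `D` at most the square root of the size of the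
matching, the parities of a random point of `A` along a random matching are nearly uniform. -/
theorem sum_perm_sum_abs_card_fiber_sub_le {κ ι : Type*} [Fintype κ] [DecidableEq κ] [Fintype ι]
    [DecidableEq ι] (A : Finset (ι → Bool)) (e : κ × Bool ↪ ι) {D L : ℕ} (hL : 6 ≤ L)
    (hκ : 1 ≤ Fintype.card κ) (hn : 2 * L * Fintype.card κ ≤ Fintype.card ι)
    (hD : D ^ 2 ≤ Fintype.card κ) (hA : (2 : ℝ) ^ Fintype.card ι ≤ 2 ^ D * #A) :
    ∑ σ : Equiv.Perm ι, ∑ w : κ → Bool,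
        |(#{x ∈ A | pairParity (e.trans σ.toEmbedding) x = w} : ℝ) - #A / 2 ^ Fintype.card κ|
      ≤ (Fintype.card ι).factorial * #A * (6 / L) := by
  have h1 := sum_perm_sum_charSum_sq_le A e hL hκ hn hD hA
  simp only [← sum_sq_card_fiber_sub] at h1
  rw [← mul_sum, ← Fintype.sum_prod_type'] at h1
  rw [← Fintype.sum_prod_type']
  refine (pow_le_pow_iff_left₀ (by positivity) (by positivity) two_ne_zero).mp ?_
  refine (sq_sum_le_card_mul_sum_sq).trans ?_
  simp only [sq_abs, card_univ, Fintype.card_prod, Fintype.card_perm, Fintype.card_fun,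
    Fintype.card_bool, Nat.cast_mul, Nat.cast_pow, Nat.cast_ofNat]
  rw [mul_assoc]
  refine (mul_le_mul_of_nonneg_left h1 (by positivity)).trans (le_of_eq ?_)
  ring

/-! ### One-way communication of hidden parities -/

/-- The protocol behind the lower bound. One party sends `state x` about a uniform point `x` of the
cube; the other one knows a random matching `σ` and the parities of `x` along it, masked by one of
the patterns `b i`, and has to tell `i`. As the parities are nearly uniform given the message, the
masked parities are nearly independent of `i`. -/
theorem sum_card_correct_le {κ ι I Mem : Type*} [Fintype κ] [DecidableEq κ] [Fintype ι]
    [DecidableEq ι] [Fintype I] [Fintype Mem] [DecidableEq Mem] (e : κ × Bool ↪ ι) {D L : ℕ}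
    (hL : 6 ≤ L) (hκ : 1 ≤ Fintype.card κ) (hn : 2 * L * Fintype.card κ ≤ Fintype.card ι)
    (hD : D ^ 2 ≤ Fintype.card κ) (state : (ι → Bool) → Mem) (b : I → κ → Bool)
    (B : I → Mem → Equiv.Perm ι → (κ → Bool) → Prop) [∀ i s σ w, Decidable (B i s σ w)]
    (hB : ∀ i i' s σ w, B i s σ w → B i' s σ w → i = i') :
    ∑ i, ∑ σ : Equiv.Perm ι, (#{x | B i (state x) σ
        (fun j => xor (pairParity (e.trans σ.toEmbedding) x j) (b i j))} : ℝ)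
      ≤ (Fintype.card ι).factorial * 2 ^ Fintype.card ι *
        (1 + Fintype.card I * (6 / L + 2 * Fintype.card Mem / 2 ^ D)) := by
  set n := Fintype.card ι with hn'
  set M : ℝ := 2 ^ Fintype.card κ with hM
  have hM0 : 0 < M := by positivity
  set A : Mem → Finset (ι → Bool) := fun s => {x | state x = s} with hAdef
  set cnt : Mem → Equiv.Perm ι → (κ → Bool) → ℝ :=
    fun s σ w => (#{x ∈ A s | pairParity (e.trans σ.toEmbedding) x = w} : ℝ) with hcnt
  have hcnt0 : ∀ s σ w, 0 ≤ cnt s σ w := fun s σ w => Nat.cast_nonneg _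
  have hcardw : ((#(univ : Finset (κ → Bool)) : ℕ) : ℝ) = M := by simp [hM]
  have hcntsum : ∀ s σ, ∑ w, cnt s σ w = #(A s) := by
    intro s σ
    simp only [hcnt]
    rw [← Nat.cast_sum, ← card_eq_sum_card_fiberwise fun x _ => mem_coe.mpr (mem_univ _)]
  have hAsum : ∑ s, (#(A s) : ℝ) = 2 ^ n := by
    rw [← Nat.cast_sum]
    have h := card_eq_sum_card_fiberwise (f := state) (s := univ) (t := univ)
      fun x _ => mem_coe.mpr (mem_univ _)
    rw [← h]
    simp [hn']
  set T : Mem → Equiv.Perm ι → (κ → Bool) → ℝ := fun s σ w => |cnt s σ w - #(A s) / M| with hT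
  have hsplit : ∀ i σ, (#{x | B i (state x) σ
        (fun j => xor (pairParity (e.trans σ.toEmbedding) x j) (b i j))} : ℝ)
      ≤ ∑ s, ((∑ w, if B i s σ w then (#(A s) : ℝ) / M else 0) + ∑ w, T s σ w) := by
    intro i σ
    have h1 : (#{x | B i (state x) σ
        (fun j => xor (pairParity (e.trans σ.toEmbedding) x j) (b i j))} : ℝ)
        = ∑ s, ∑ w, if B i s σ (fun j => xor (w j) (b i j)) then cnt s σ w else 0 := by
      have h2 : ∀ s w, (if B i s σ (fun j => xor (w j) (b i j)) then cnt s σ w else 0)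
          = ∑ x : ι → Bool, if state x = s then
              (if pairParity (e.trans σ.toEmbedding) x = w then
              (if B i s σ (fun j => xor (w j) (b i j)) then (1 : ℝ) else 0) else 0) else 0 := by
        intro s w
        simp only [hcnt, hAdef, card_filter, Nat.cast_sum, filter_filter]
        split_ifs with h
        · refine sum_congr rfl fun x _ => ?_
          by_cases h3 : state x = s <;> by_cases h4 : pairParity (e.trans σ.toEmbedding) x = w <;>
            simp [h3, h4]
        · simp
      simp only [h2]
      rw [card_filter, Nat.cast_sum]
      rw [sum_congr rfl fun s _ => sum_comm, sum_comm]
      refine sum_congr rfl fun x _ => ?_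
      have h5 : ∀ s, (∑ w, if state x = s then
              (if pairParity (e.trans σ.toEmbedding) x = w then
              (if B i s σ (fun j => xor (w j) (b i j)) then (1 : ℝ) else 0) else 0) else 0)
          = if state x = s then
              (if B i s σ (fun j => xor (pairParity (e.trans σ.toEmbedding) x j) (b i j))
              then (1 : ℝ) else 0) else 0 := by
        intro s
        split_ifs with h <;> simp [*]
      simp only [h5]
      simp
    rw [h1]
    refine sum_le_sum fun s _ => ?_
    have hshift : ∑ w, (if B i s σ w then (#(A s) : ℝ) / M else 0)
        = ∑ w : κ → Bool,
          if B i s σ (fun j => xor (w j) (b i j)) then (#(A s) : ℝ) / M else 0 := by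
      have hinv : Function.Involutive fun (w : κ → Bool) j => xor (w j) (b i j) :=
        fun w => by funext j; simp
      exact (Fintype.sum_equiv hinv.toPerm _ _ fun w => rfl).symm
    rw [hshift, ← sum_add_distrib]
    refine sum_le_sum fun w _ => ?_
    have h6 : cnt s σ w - #(A s) / M ≤ T s σ w := le_abs_self _
    have h7 : 0 ≤ T s σ w := abs_nonneg _
    split_ifs <;> linarith
  have hfirst : ∀ s σ, ∑ i, ∑ w, (if B i s σ w then (#(A s) : ℝ) / M else 0) ≤ #(A s) := by
    intro s σ
    rw [sum_comm]
    calc _ ≤ ∑ w : κ → Bool, (#(A s) : ℝ) / M := by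
          refine sum_le_sum fun w _ => ?_
          have hdiv : (0 : ℝ) ≤ #(A s) / M := by positivity
          by_cases h : ∃ i, B i s σ w
          · obtain ⟨i, hi⟩ := h
            rw [sum_eq_single i (fun i' _ hne => if_neg fun h' => hne (hB _ _ _ _ _ h' hi))
              (by simp), if_pos hi]
          · push Not at h
            simp only [h, if_false, sum_const_zero]
            exact hdiv
      _ = _ := by
          rw [sum_const, nsmul_eq_mul, hcardw]
          field_simp
  have hsecond : ∀ s, ∑ σ, ∑ w, T s σ w
      ≤ n.factorial * (#(A s) * (6 / L) + 2 * (2 ^ n / 2 ^ D)) := by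
    intro s
    by_cases hA : (2 : ℝ) ^ n ≤ 2 ^ D * #(A s)
    · refine (sum_perm_sum_abs_card_fiber_sub_le (A s) e hL hκ hn hD hA).trans ?_
      rw [mul_assoc]
      refine mul_le_mul_of_nonneg_left ?_ (by positivity)
      have : (0 : ℝ) ≤ 2 * (2 ^ n / 2 ^ D) := by positivity
      linarith
    -- Nothing is known about the parities given an unlikely message; the trivial bound is enough.
    · have hA' : (#(A s) : ℝ) ≤ 2 ^ n / 2 ^ D := by
        rw [le_div_iff₀ (by positivity), mul_comm]
        exact (not_le.mp hA).le
      have h1 : ∀ σ, ∑ w, T s σ w ≤ 2 * #(A s) := by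
        intro σ
        calc ∑ w, T s σ w ≤ ∑ w, (cnt s σ w + #(A s) / M) := by
              refine sum_le_sum fun w _ => ?_
              have hdiv : (0 : ℝ) ≤ #(A s) / M := by positivity
              refine (abs_sub _ _).trans ?_
              rw [abs_of_nonneg (hcnt0 s σ w), abs_of_nonneg hdiv]
          _ = _ := by
              rw [sum_add_distrib, hcntsum, sum_const, nsmul_eq_mul, hcardw]
              field_simp
              norm_num
      calc _ ≤ ∑ σ : Equiv.Perm ι, 2 * (#(A s) : ℝ) := sum_le_sum fun σ _ => h1 σ
        _ = n.factorial * (2 * #(A s)) := by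
            rw [sum_const, card_univ, Fintype.card_perm, nsmul_eq_mul]
        _ ≤ _ := by
            have : (0 : ℝ) ≤ #(A s) * (6 / L) := by positivity
            gcongr
            linarith
  calc _ ≤ ∑ i : I, ∑ σ, ∑ s, ((∑ w, if B i s σ w then (#(A s) : ℝ) / M else 0)
            + ∑ w, T s σ w) := sum_le_sum fun i _ => sum_le_sum fun σ _ => hsplit i σ
    _ = ∑ σ : Equiv.Perm ι, ∑ s, ∑ i, (∑ w, if B i s σ w then (#(A s) : ℝ) / M else 0)
          + Fintype.card I * ∑ s, ∑ σ, ∑ w, T s σ w := by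
        simp only [sum_add_distrib]
        congr 1
        · rw [sum_comm]
          exact sum_congr rfl fun σ _ => sum_comm
        · rw [sum_const, card_univ, nsmul_eq_mul, sum_comm]
    _ ≤ ∑ σ : Equiv.Perm ι, ∑ s, (#(A s) : ℝ) + Fintype.card I * ∑ s : Mem,
          (n.factorial : ℝ) * (#(A s) * (6 / L) + 2 * (2 ^ n / 2 ^ D)) := by
        refine add_le_add (sum_le_sum fun σ _ => sum_le_sum fun s _ => hfirst s σ) ?_
        gcongr with s _
        exact hsecond s
    _ = _ := by
        rw [← mul_sum, sum_add_distrib, ← sum_mul, hAsum]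
        simp only [sum_const, card_univ, Fintype.card_perm, nsmul_eq_mul]
        ring

/-! ### The hard input streams -/

/-- The vertices of `r` disjoint hubs with `d` triangles each, as in `hubsGraph r d`. -/
abbrev HubVertex (r d : ℕ) : Type := Fin r × Option (Fin d × Bool)

/-- The first part of the stream encodes `x : Fin d → Bool`: in each copy, the hub is joined to
exactly one of the two vertices over `v`, namely the one with label `x v`. -/
noncomputable def spokeStream (r : ℕ) {d : ℕ} (x : Fin d → Bool) : List (Sym2 (HubVertex r d)) :=
  (univ : Finset (Fin r × Fin d)).toList.map
    fun a => s((a.1, none), (a.1, some (a.2, x a.2)))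

/-- The second part of the stream encodes a matching `p` and a mask `w`: the two vertices over
`p (j, false)` are joined to the two vertices over `p (j, true)`, in parallel or crosswise according
to `w j`. -/
noncomputable def matchingStream (r : ℕ) {d : ℕ} {κ : Type} [Fintype κ] (p : κ × Bool ↪ Fin d)
    (w : κ → Bool) : List (Sym2 (HubVertex r d)) :=
  (univ : Finset (Fin r × κ × Bool)).toList.map
    fun a => s((a.1, some (p (a.2.1, false), a.2.2)),
      (a.1, some (p (a.2.1, true), xor a.2.2 (w a.2.1))))

section
variable {r d : ℕ} {κ : Type} [Fintype κ]

theorem mem_spokeStream {x : Fin d → Bool} {e : Sym2 (HubVertex r d)} :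
    e ∈ spokeStream r x ↔ ∃ i v, e = s((i, none), (i, some (v, x v))) := by
  simp [spokeStream, eq_comm]

theorem mem_matchingStream {p : κ × Bool ↪ Fin d} {w : κ → Bool} {e : Sym2 (HubVertex r d)} :
    e ∈ matchingStream r p w ↔ ∃ i j c,
      e = s((i, some (p (j, false), c)), (i, some (p (j, true), xor c (w j)))) := by
  simp only [matchingStream, List.mem_map, mem_toList, mem_univ, true_and, Prod.exists, eq_comm]

theorem nodup_hardStream (x : Fin d → Bool) (p : κ × Bool ↪ Fin d) (w : κ → Bool) :
    (spokeStream r x ++ matchingStream r p w).Nodup := by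
  rw [List.nodup_append']
  refine ⟨(nodup_toList _).map ?_, (nodup_toList _).map ?_, ?_⟩
  · rintro ⟨i, v⟩ ⟨i', v'⟩ h
    simp at h
    ext <;> simp [h]
  · rintro ⟨i, j, c⟩ ⟨i', j', c'⟩ h
    simp at h
    aesop
  · intro e h1 h2
    obtain ⟨i, v, rfl⟩ := mem_spokeStream.mp h1
    obtain ⟨i', j, c, h⟩ := mem_matchingStream.mp h2
    simp at h

/-- The graph whose edges form the stream. -/
def hardGraph (r : ℕ) {d : ℕ} (x : Fin d → Bool) (p : κ × Bool ↪ Fin d) (w : κ → Bool) :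
    SimpleGraph (HubVertex r d) :=
  SimpleGraph.fromEdgeSet {e | e ∈ spokeStream r x ++ matchingStream r p w}

theorem mem_edgeSet_hardGraph {x : Fin d → Bool} {p : κ × Bool ↪ Fin d} {w : κ → Bool}
    {e : Sym2 (HubVertex r d)} :
    e ∈ (hardGraph r x p w).edgeSet ↔ e ∈ spokeStream r x ++ matchingStream r p w := by
  rw [hardGraph, SimpleGraph.edgeSet_fromEdgeSet]
  simp only [Set.mem_sdiff, Set.mem_ofPred_eq, and_iff_left_iff_imp, List.mem_append]
  rintro (h | h)
  · obtain ⟨i, v, rfl⟩ := mem_spokeStream.mp h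
    simp
  · obtain ⟨i, j, c, rfl⟩ := mem_matchingStream.mp h
    simp

theorem hardGraph_adj_hub {x : Fin d → Bool} {p : κ × Bool ↪ Fin d} {w : κ → Bool} {i i' : Fin r}
    {a : Option (Fin d × Bool)} :
    (hardGraph r x p w).Adj (i, none) (i', a) ↔ i' = i ∧ ∃ v, a = some (v, x v) := by
  rw [← SimpleGraph.mem_edgeSet, mem_edgeSet_hardGraph, List.mem_append, mem_spokeStream,
    mem_matchingStream]
  constructor
  · rintro (⟨i, v, h⟩ | ⟨i, j, c, h⟩)
    · simp at h
      aesop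
    · simp at h
  · rintro ⟨rfl, v, rfl⟩
    exact Or.inl ⟨_, v, rfl⟩

theorem hardGraph_adj_some {x : Fin d → Bool} {p : κ × Bool ↪ Fin d} {w : κ → Bool} {i i' : Fin r}
    {a a' : Fin d × Bool} :
    (hardGraph r x p w).Adj (i, some a) (i', some a') ↔ i' = i ∧ ∃ j,
      (a.1 = p (j, false) ∧ a'.1 = p (j, true) ∨ a.1 = p (j, true) ∧ a'.1 = p (j, false)) ∧
        xor a.2 a'.2 = w j := by
  obtain ⟨v, c⟩ := a
  obtain ⟨v', c'⟩ := a'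
  rw [← SimpleGraph.mem_edgeSet, mem_edgeSet_hardGraph, List.mem_append, mem_spokeStream,
    mem_matchingStream]
  constructor
  · rintro (⟨i, v, h⟩ | ⟨i, j, c, h⟩)
    · simp at h
    · simp at h
      rcases h with ⟨⟨rfl, rfl, rfl⟩, rfl, rfl, rfl⟩ | ⟨⟨rfl, rfl, rfl⟩, rfl, rfl, rfl⟩ <;>
        exact ⟨rfl, j, by simp, by simp [Bool.xor_comm]⟩
  · rintro ⟨rfl, j, ⟨h1, h2⟩ | ⟨h1, h2⟩, h3⟩ <;> dsimp only at h1 h2 h3 <;> subst h1 h2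
    · exact Or.inr ⟨i', j, c, by rw [← h3]; simp⟩
    · exact Or.inr ⟨i', j, c', by rw [Sym2.eq_swap, ← h3, Bool.xor_comm c]; simp⟩

/-- The triangles are those of the hub with a matching edge both ends of which are joined to it. -/
theorem triangleCount_hardGraph (x : Fin d → Bool) (p : κ × Bool ↪ Fin d) (w : κ → Bool) :
    triangleCount (hardGraph r x p w) = r * #{j | pairParity p x j = w j} := by
  classical
  set t : Fin r × κ → Finset (HubVertex r d) := fun a => {(a.1, none),
    (a.1, some (p (a.2, false), x (p (a.2, false)))),
    (a.1, some (p (a.2, true), x (p (a.2, true))))} with ht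
  have hinj : Function.Injective t := by
    rintro ⟨i, j⟩ ⟨i', j'⟩ h
    have h1 : (i, some (p (j, false), x (p (j, false)))) ∈ t (i', j') := by
      rw [← h]; simp [ht]
    simp [ht] at h1
    aesop
  have hset : (hardGraph r x p w).cliqueSet 3
      = ↑((univ ×ˢ ({j | pairParity p x j = w j} : Finset κ)).image t) := by
    ext s
    simp only [SimpleGraph.mem_cliqueSet_iff, coe_image, Set.mem_image, mem_coe, mem_product,
      mem_univ, true_and, mem_filter]
    constructor
    · intro hs
      -- A triangle that contains the hub.
      have main : ∀ i b c, (hardGraph r x p w).Adj (i, none) b →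
          (hardGraph r x p w).Adj (i, none) c → (hardGraph r x p w).Adj b c →
          ∃ a : Fin r × κ, pairParity p x a.2 = w a.2 ∧ t a = {(i, none), b, c} := by
        rintro i ⟨ib, b⟩ ⟨ic, c⟩ h1 h2 h3
        obtain ⟨rfl, v, rfl⟩ := hardGraph_adj_hub.mp h1
        obtain ⟨rfl, v', rfl⟩ := hardGraph_adj_hub.mp h2
        obtain ⟨-, j, ⟨h4, h5⟩ | ⟨h4, h5⟩, h6⟩ := hardGraph_adj_some.mp h3 <;>
          dsimp only at h4 h5 h6 <;> subst h4 h5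
        · exact ⟨(_, j), h6, rfl⟩
        · refine ⟨(ic, j), by rw [← h6, Bool.xor_comm]; rfl, ?_⟩
          simp only [ht]
          rw [pair_comm]
      obtain ⟨⟨ia, a⟩, ⟨ib, b⟩, ⟨ic, c⟩, hab, hac, hbc, rfl⟩ :=
        SimpleGraph.is3Clique_iff.mp hs
      rcases a with _ | a
      · exact main _ _ _ hab hac hbc
      rcases b with _ | b
      · obtain ⟨a', h1, h2⟩ := main _ _ _ hab.symm hbc hac
        exact ⟨a', h1, by rw [h2, insert_comm]⟩
      rcases c with _ | c
      · obtain ⟨a', h1, h2⟩ := main _ _ _ hac.symm hbc.symm hab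
        refine ⟨a', h1, by rw [h2, insert_comm, pair_comm (ic, none)]⟩
      -- There is no triangle without a hub, as the other edges join points over a matching.
      exfalso
      obtain ⟨-, j, h1, -⟩ := hardGraph_adj_some.mp hab
      obtain ⟨-, j', h2, -⟩ := hardGraph_adj_some.mp hac
      obtain ⟨-, j'', h3, -⟩ := hardGraph_adj_some.mp hbc
      rcases h1 with ⟨h1, h1'⟩ | ⟨h1, h1'⟩ <;> rcases h2 with ⟨h2, h2'⟩ | ⟨h2, h2'⟩ <;>
        rcases h3 with ⟨h3, h3'⟩ | ⟨h3, h3'⟩ <;> simp_all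
    · rintro ⟨⟨i, j⟩, hj, rfl⟩
      refine SimpleGraph.is3Clique_iff.mpr ⟨_, _, _, ?_, ?_, ?_, rfl⟩
      · exact hardGraph_adj_hub.mpr ⟨rfl, _, rfl⟩
      · exact hardGraph_adj_hub.mpr ⟨rfl, _, rfl⟩
      · exact hardGraph_adj_some.mpr ⟨rfl, j, Or.inl ⟨rfl, rfl⟩, hj⟩
  rw [triangleCount, hset, Set.ncard_coe_finset, card_image_of_injective _ hinj]
  simp

theorem triangleCount_hubsGraph_le (r d : ℕ) : triangleCount (hubsGraph r d) ≤ r * d := by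
  classical
  set t : Fin r × Fin d → Finset (HubVertex r d) := fun a =>
    {(a.1, none), (a.1, some (a.2, false)), (a.1, some (a.2, true))} with ht
  have hsub : (hubsGraph r d).cliqueSet 3 ⊆ ↑(univ.image t) := by
    intro s hs
    -- A triangle that contains the hub.
    have main : ∀ i b c, (hubsGraph r d).Adj (i, none) b → (hubsGraph r d).Adj (i, none) c →
        (hubsGraph r d).Adj b c → ∃ a, t a = {(i, none), b, c} := by
      rintro i ⟨ib, _ | ⟨v, b⟩⟩ ⟨ic, _ | ⟨v', c⟩⟩ ⟨h1, h1', -⟩ ⟨h2, h2', -⟩ ⟨h3, h3', h3''⟩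
      · exact absurd rfl h1'
      · exact absurd rfl h1'
      · exact absurd rfl h2'
      · dsimp only at h1 h2
        subst h1 h2
        obtain rfl : v = v' := by simpa using h3''
        have hbc : b ≠ c := fun h => h3' (by rw [h])
        refine ⟨(i, v), ?_⟩
        cases b <;> cases c <;> first | exact absurd rfl hbc | rfl | skip
        simp only [ht]
        rw [pair_comm]
    obtain ⟨⟨ia, a⟩, ⟨ib, b⟩, ⟨ic, c⟩, hab, hac, hbc, rfl⟩ :=
      SimpleGraph.is3Clique_iff.mp hs
    simp only [coe_image, coe_univ, Set.image_univ, Set.mem_range]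
    rcases a with _ | ⟨v, a⟩
    · exact main _ _ _ hab hac hbc
    rcases b with _ | ⟨v', b⟩
    · obtain ⟨a', h⟩ := main _ _ _ hab.symm hbc hac
      exact ⟨a', by rw [h, insert_comm]⟩
    rcases c with _ | ⟨v'', c⟩
    · obtain ⟨a', h⟩ := main _ _ _ hac.symm hbc.symm hab
      exact ⟨a', by rw [h, insert_comm, pair_comm (ic, none)]⟩
    -- Without a hub, the three vertices would lie among the two further vertices of one triangle.
    exfalso
    obtain ⟨-, h1, h1'⟩ := hab
    obtain ⟨-, h2, h2'⟩ := hac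
    obtain ⟨-, h3, h3'⟩ := hbc
    obtain rfl : v = v' := by simpa using h1'
    obtain rfl : v = v'' := by simpa using h2'
    cases a <;> cases b <;> cases c <;> simp_all
  calc triangleCount (hubsGraph r d) ≤ #(univ.image t) := by
        rw [triangleCount, ← Set.ncard_coe_finset]
        exact Set.ncard_le_ncard hsub (finite_toSet _)
    _ ≤ #(univ : Finset (Fin r × Fin d)) := card_image_le
    _ = r * d := by simp

/-- Over each matched pair of points, the two edges are sent to two of the edges of `hubsGraph r d`
that avoid the hubs. -/
theorem hardGraph_isContained (x : Fin d → Bool) (p : κ × Bool ↪ Fin d) (w : κ → Bool) :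
    (hardGraph r x p w).IsContained (hubsGraph r d) := by
  classical
  set ψ : Fin d × Bool → Fin d × Bool := fun a =>
    if h : ∃ b, p b = a.1 then (p (h.choose.1, xor a.2 (h.choose.2 && w h.choose.1)), h.choose.2)
    else a with hψ
  have hψp : ∀ b c, ψ (p b, c) = (p (b.1, xor c (b.2 && w b.1)), b.2) := by
    intro b c
    have h : ∃ b', p b' = (p b, c).1 := ⟨b, rfl⟩
    have hb : h.choose = b := p.injective h.choose_spec
    simp only [hψ]
    rw [dif_pos h, hb]
  have hψn : ∀ a : Fin d × Bool, a.1 ∉ Set.range p → ψ a = a := by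
    intro a ha
    simp only [hψ]
    rw [dif_neg fun ⟨b, hb⟩ => ha ⟨b, hb⟩]
  have hinj : Function.Injective ψ := by
    rintro ⟨v, c⟩ ⟨v', c'⟩ h
    by_cases h1 : v ∈ Set.range p <;> by_cases h2 : v' ∈ Set.range p
    · obtain ⟨⟨j, s⟩, rfl⟩ := h1
      obtain ⟨⟨j', s'⟩, rfl⟩ := h2
      rw [hψp, hψp] at h
      simp at h
      obtain ⟨⟨rfl, h⟩, rfl⟩ := h
      simpa using h
    · obtain ⟨b, rfl⟩ := h1
      rw [hψp, hψn (v', c') h2, Prod.mk.injEq] at h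
      exact absurd ⟨_, h.1⟩ h2
    · obtain ⟨b, rfl⟩ := h2
      rw [hψp, hψn (v, c) h1, Prod.mk.injEq] at h
      exact absurd ⟨_, h.1.symm⟩ h1
    · rwa [hψn (v, c) h1, hψn (v', c') h2] at h
  have hinj' : Function.Injective
      fun a : HubVertex r d => ((a.1, a.2.map ψ) : HubVertex r d) := by
    rintro ⟨i, a⟩ ⟨i', a'⟩ h
    simp only [Prod.mk.injEq] at h
    obtain ⟨rfl, h⟩ := h
    rw [Option.map_injective hinj h]
  refine ⟨SimpleGraph.Hom.toCopy ⟨fun a => (a.1, a.2.map ψ), ?_⟩ hinj'⟩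
  rintro ⟨i, a⟩ ⟨i', a'⟩ h
  have hi : i' = i := by
    rcases a with _ | a
    · exact (hardGraph_adj_hub.mp h).1
    · rcases a' with _ | a'
      · exact (hardGraph_adj_hub.mp h.symm).1.symm
      · exact (hardGraph_adj_some.mp h).1
  subst hi
  refine ⟨rfl, fun h' => h.ne (hinj' (Prod.ext rfl h')), ?_⟩
  rcases a with _ | a
  · exact Or.inl rfl
  rcases a' with _ | a'
  · exact Or.inr (Or.inl rfl)
  refine Or.inr (Or.inr ?_)
  obtain ⟨v, c⟩ := a
  obtain ⟨v', c'⟩ := a'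
  obtain ⟨-, j, ⟨h1, h2⟩ | ⟨h1, h2⟩, h3⟩ := hardGraph_adj_some.mp h <;>
    dsimp only at h1 h2 h3 <;> subst h1 h2 <;>
    cases c <;> cases c' <;> simp [hψp, ← h3]

end

theorem isNClique_map_of_iso {V V' : Type*} {G : SimpleGraph V} {G' : SimpleGraph V'}
    (f : G ≃g G') {n : ℕ} {s : Finset V} (hs : G.IsNClique n s) :
    G'.IsNClique n (s.map f.toEquiv.toEmbedding) := by
  refine (hs.map (f := f.toEquiv.toEmbedding)).mono ?_
  rintro _ _ ⟨-, a, b, hab, rfl, rfl⟩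
  exact f.map_adj_iff.mpr hab

theorem triangleCount_eq_of_iso {V V' : Type*} {G : SimpleGraph V} {G' : SimpleGraph V'}
    (f : G ≃g G') : triangleCount G = triangleCount G' := by
  have himg : G'.cliqueSet 3 = (fun s : Finset V => s.map f.toEquiv.toEmbedding) ''
      G.cliqueSet 3 := by
    ext s
    constructor
    · intro hs
      refine ⟨_, isNClique_map_of_iso f.symm hs, ?_⟩
      ext y
      simp only [mem_map_equiv]
      exact iff_of_eq (congrArg (· ∈ s) (f.apply_symm_apply y))
    · rintro ⟨s, hs, rfl⟩
      exact isNClique_map_of_iso f hs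
  rw [triangleCount, triangleCount, himg, Set.ncard_image_of_injective _ (map_injective _)]

/-! ### From streaming algorithms to protocols -/

namespace StreamingAlgorithm

theorem runFrom_append {W : Type*} {S : ℕ} (A : StreamingAlgorithm W S) (ω : A.Ω) (t : ℕ)
    (s : Memory S) (l l' : List (Sym2 W)) :
    A.runFrom ω t s (l ++ l') = A.runFrom ω (t + l.length) (A.runFrom ω t s l) l' := by
  induction l generalizing t s with
  | nil => rfl
  | cons e l ih =>
    simp only [List.cons_append, runFrom, ih, List.length_cons]
    congr 1
    omega

theorem measurable_apply_memory {Ω β : Type*} [MeasurableSpace Ω] [MeasurableSpace β] {S : ℕ}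
    {f : Ω → Memory S → β} (hf : ∀ s, Measurable fun ω => f ω s) {g : Ω → Memory S}
    (hg : Measurable g) : Measurable fun ω => f ω (g ω) := by
  have h : Measurable fun a : Ω × Memory S => f a.1 a.2 :=
    measurable_from_prod_countable_left hf
  exact h.comp (measurable_id.prodMk hg)

theorem measurable_runFrom {W : Type*} {S : ℕ} (A : StreamingAlgorithm W S) (t : ℕ)
    (l : List (Sym2 W)) {g : A.Ω → Memory S} (hg : Measurable g) :
    Measurable fun ω => A.runFrom ω t (g ω) l := by
  induction l generalizing t g with
  | nil => exact hg
  | cons e l ih =>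
    exact ih (t + 1) (measurable_apply_memory (fun s => A.measurable_step t e s) hg)

theorem measurable_result {W : Type*} {S : ℕ} (A : StreamingAlgorithm W S) (l : List (Sym2 W)) :
    Measurable fun ω => A.result ω l :=
  measurable_apply_memory A.measurable_output (A.measurable_runFrom 0 l A.measurable_start)

/-- An algorithm that solves `hubsGraph r d` is correct on all the hard streams. -/
theorem Solves.hardStream {W : Type*} {S : ℕ} {A : StreamingAlgorithm W S} {r d : ℕ} {ε δ : ℝ}
    (hA : A.Solves (hubsGraph r d) ε δ) (hε : 0 ≤ ε) (f : HubVertex r d ↪ W) {κ : Type} [Fintype κ]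
    (x : Fin d → Bool) (p : κ × Bool ↪ Fin d) (w : κ → Bool) :
    1 - δ ≤ A.μ.real {ω |
      |A.result ω ((spokeStream r x ++ matchingStream r p w).map (Sym2.map f))
        - r * #{j | pairParity p x j = w j}| ≤ ε * (r * d)} := by
  set F : SimpleGraph.Copy (hardGraph r x p w) (⊤ : SimpleGraph W) :=
    SimpleGraph.Hom.toCopy ⟨f, fun h => f.injective.ne h.ne⟩ f.injective with hF
  have hcont : F.toSubgraph.coe.IsContained (hubsGraph r d) :=
    F.isoToSubgraph.symm.isContained.trans (hardGraph_isContained x p w)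
  have hcount : triangleCount F.toSubgraph.coe = r * #{j | pairParity p x j = w j} := by
    rw [← triangleCount_eq_of_iso F.isoToSubgraph, triangleCount_hardGraph]
  have h := hA F.toSubgraph hcont ((spokeStream r x ++ matchingStream r p w).map (Sym2.map f))
    ((nodup_hardStream x p w).map (Sym2.map.injective f.injective)) ?_
  · refine h.trans (MeasureTheory.measureReal_mono ?_)
    intro ω hω
    simp only [Set.mem_ofPred_eq, hcount, Nat.cast_mul] at hω ⊢
    refine hω.trans ?_
    gcongr
    exact_mod_cast triangleCount_hubsGraph_le r d
  · intro e
    rw [SimpleGraph.Subgraph.edgeSet_map, SimpleGraph.Subgraph.edgeSet_top, List.mem_map]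
    simp only [Set.mem_image, mem_edgeSet_hardGraph]
    rfl

/-- An algorithm that is correct with probability `1 - δ` on `K` kinds of hard streams, with
different numbers of triangles, yields a protocol for the hidden parities. The message is the memory
after the spokes, and the coins are fixed so that the protocol is correct on a fraction `1 - δ` of
the inputs at least. -/
theorem Solves.mul_one_sub_le {W : Type*} {S : ℕ} {A : StreamingAlgorithm W S} {r d : ℕ}
    {ε δ : ℝ} (hA : A.Solves (hubsGraph r d) ε δ) (hε : 0 ≤ ε) (hr : 1 ≤ r)
    (f : HubVertex r d ↪ W) {K h L D : ℕ} (hL : 6 ≤ L) (hKh : 1 ≤ K * h)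
    (hd : 2 * L * (K * h) ≤ d) (hD : D ^ 2 ≤ K * h) (hεh : 2 * ε * d < h) :
    K * (1 - δ) ≤ 1 + K * (6 / L + 2 * 2 ^ S / 2 ^ D) := by
  classical
  have hcardκ : Fintype.card (Fin K × Fin h) = K * h := by simp
  obtain ⟨e⟩ : Nonempty ((Fin K × Fin h) × Bool ↪ Fin d) := by
    refine Function.Embedding.nonempty_of_card_le ?_
    simp only [Fintype.card_prod, Fintype.card_fin, Fintype.card_bool]
    nlinarith
  have hr' : (0 : ℝ) < r := by exact_mod_cast hr
  -- The masks: pattern `i` leaves exactly `i * h` parities unchanged.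
  set b : Fin K → Fin K × Fin h → Bool := fun i j => decide (i ≤ j.1) with hb
  have hbcard : ∀ i, #{j | b i j = false} = i * h := by
    intro i
    have : ({j | b i j = false} : Finset (Fin K × Fin h)) = Iio i ×ˢ univ := by
      ext ⟨a, c⟩
      simp [hb]
    rw [this]
    simp
  set E : Fin K → Equiv.Perm (Fin d) → (Fin d → Bool) → Set A.Ω := fun i σ x => {ω |
    |A.result ω ((spokeStream r x ++ matchingStream r (e.trans σ.toEmbedding)
      fun j => xor (pairParity (e.trans σ.toEmbedding) x j) (b i j)).map (Sym2.map f))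
        - r * (i * h)| ≤ ε * (r * d)} with hE
  have hEprob : ∀ i σ x, 1 - δ ≤ A.μ.real (E i σ x) := by
    intro i σ x
    have h1 := hA.hardStream hε f x (e.trans σ.toEmbedding)
      fun j => xor (pairParity (e.trans σ.toEmbedding) x j) (b i j)
    have h2 : #{j | pairParity (e.trans σ.toEmbedding) x j
        = xor (pairParity (e.trans σ.toEmbedding) x j) (b i j)} = i * h := by
      have hxor : ∀ a c : Bool, a = xor a c ↔ c = false := by decide
      simp only [hxor, hbcard]
    rw [h2, Nat.cast_mul] at h1
    exact h1
  have hEmeas : ∀ i σ x, MeasurableSet (E i σ x) := fun i σ x =>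
    measurableSet_le ((A.measurable_result _).sub_const _).abs measurable_const
  -- Some outcome of the coins is at least as good as the average.
  obtain ⟨ω, hω⟩ : ∃ ω, (K : ℝ) * (d.factorial * 2 ^ d) * (1 - δ)
      ≤ ∑ i, ∑ σ, ∑ x, (E i σ x).indicator (fun _ => (1 : ℝ)) ω := by
    have hint : ∀ i σ x, MeasureTheory.Integrable ((E i σ x).indicator fun _ => (1 : ℝ)) A.μ :=
      fun i σ x => (MeasureTheory.integrable_const _).indicator (hEmeas i σ x)
    obtain ⟨ω, hω⟩ := MeasureTheory.exists_integral_le (μ := A.μ)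
      (f := fun ω => ∑ i, ∑ σ, ∑ x, (E i σ x).indicator (fun _ => (1 : ℝ)) ω)
      (MeasureTheory.integrable_finsetSum _ fun i _ => MeasureTheory.integrable_finsetSum _
        fun σ _ => MeasureTheory.integrable_finsetSum _ fun x _ => hint i σ x)
    refine ⟨ω, le_trans ?_ hω⟩
    rw [MeasureTheory.integral_finsetSum _ fun i _ => MeasureTheory.integrable_finsetSum _
        fun σ _ => MeasureTheory.integrable_finsetSum _ fun x _ => hint i σ x]
    simp_rw [MeasureTheory.integral_finsetSum _ fun σ _ =>
      MeasureTheory.integrable_finsetSum _ fun x _ => hint _ σ x,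
      MeasureTheory.integral_finsetSum _ fun x _ => hint _ _ x,
      MeasureTheory.integral_indicator_const _ (hEmeas _ _ _)]
    calc (K : ℝ) * (d.factorial * 2 ^ d) * (1 - δ)
        = ∑ i : Fin K, ∑ σ : Equiv.Perm (Fin d), ∑ x : Fin d → Bool, (1 - δ) := by
          simp [Fintype.card_perm]
          ring
      _ ≤ _ := by
          refine sum_le_sum fun i _ => sum_le_sum fun σ _ => sum_le_sum fun x _ => ?_
          simpa using hEprob i σ x
  set state : (Fin d → Bool) → Memory S := fun x =>
    A.runFrom ω 0 (A.start ω) ((spokeStream r x).map (Sym2.map f)) with hstate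
  set B : Fin K → Memory S → Equiv.Perm (Fin d) → (Fin K × Fin h → Bool) → Prop := fun i s σ w =>
    |A.output ω (A.runFrom ω (r * d) s ((matchingStream r (e.trans σ.toEmbedding) w).map
      (Sym2.map f))) - r * (i * h)| ≤ ε * (r * d) with hBdef
  have hEB : ∀ i σ x, ω ∈ E i σ x ↔ B i (state x) σ
      fun j => xor (pairParity (e.trans σ.toEmbedding) x j) (b i j) := by
    intro i σ x
    have hlen : ((spokeStream r x).map (Sym2.map f)).length = r * d := by simp [spokeStream]
    simp only [hE, hBdef, hstate, Set.mem_ofPred_eq, result, List.map_append, runFrom_append, hlen,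
      zero_add]
  have hdisj : ∀ i i' s σ w, B i s σ w → B i' s σ w → i = i' := by
    intro i i' s σ w h1 h2
    by_contra hne
    have h3 : (1 : ℝ) ≤ |(i : ℝ) - i'| := by
      have h4 : (1 : ℤ) ≤ |(i : ℤ) - i'| :=
        Int.one_le_abs (sub_ne_zero.mpr fun h => hne (Fin.ext (by exact_mod_cast h)))
      exact_mod_cast h4
    have h5 : |(r : ℝ) * h * (i - i')| ≤ ε * (r * d) + ε * (r * d) := by
      simp only [hBdef] at h1 h2
      rw [abs_le] at h1 h2 ⊢
      constructor <;> linarith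
    rw [abs_mul, abs_of_nonneg (by positivity)] at h5
    have h6 : (r : ℝ) * h ≤ r * h * |(i : ℝ) - i'| := le_mul_of_one_le_right (by positivity) h3
    nlinarith
  have hupper := sum_card_correct_le e hL (by rw [hcardκ]; exact hKh)
    (by rw [hcardκ, Fintype.card_fin]; exact hd) (by rw [hcardκ]; exact hD) state b B hdisj
  have hsum : ∑ i, ∑ σ, ∑ x, (E i σ x).indicator (fun _ => (1 : ℝ)) ω
      = ∑ i, ∑ σ : Equiv.Perm (Fin d), (#{x | B i (state x) σ
        (fun j => xor (pairParity (e.trans σ.toEmbedding) x j) (b i j))} : ℝ) := by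
    refine sum_congr rfl fun i _ => sum_congr rfl fun σ _ => ?_
    rw [card_filter, Nat.cast_sum]
    refine sum_congr rfl fun x _ => ?_
    simp only [Set.indicator_apply, hEB, Nat.cast_ite, Nat.cast_one, Nat.cast_zero]
  rw [hsum] at hω
  have hfin := hω.trans hupper
  simp only [Fintype.card_fin, Fintype.card_fun, Fintype.card_bool, Nat.cast_pow,
    Nat.cast_ofNat] at hfin
  have hpos : (0 : ℝ) < d.factorial * 2 ^ d := by positivity
  refine le_of_mul_le_mul_left ?_ hpos
  linarith

end StreamingAlgorithm

/-! ### The lower bound -/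

theorem mainTheorem5 (δ : ℝ) (hδ0 : 0 < δ) (hδ1 : δ < 1) :
    ∃ ε₀ : ℝ, 0 < ε₀ ∧ ∃ c : ℝ, 0 < c ∧ ∃ d₀ : ℕ,
      ∀ ε : ℝ, 0 < ε → ε ≤ ε₀ →
      ∀ r : ℕ, 1 ≤ r → ∀ d : ℕ, d₀ ≤ d →
      ∀ W : Type u, Nonempty (Fin r × Option (Fin d × Bool) ↪ W) →
        ENNReal.ofReal (c * Real.sqrt (d : ℝ)) ≤
          ((instOpt W (hubsGraph r d) ε δ : ℕ∞) : ENNReal) := by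
  set β : ℝ := 1 - δ with hβ
  have hβ0 : 0 < β := by linarith
  have hβ1 : β ≤ 1 := by linarith
  -- `K` kinds of inputs, more than `2 / β`, so that a guess cannot reach probability `β` on each.
  obtain ⟨K, hK⟩ := exists_nat_gt (2 / β)
  -- `1 / L` bounds the fraction of matched points; it controls the distance from uniformity.
  obtain ⟨L, hL⟩ := exists_nat_ge (24 / β)
  -- Messages sent with probability below `2^{-(S + q)}` are negligible.
  obtain ⟨q, hq⟩ := pow_unbounded_of_one_lt (8 / β) (one_lt_two : (1 : ℝ) < 2)
  rw [div_lt_iff₀ hβ0] at hK hq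
  rw [div_le_iff₀ hβ0] at hL
  have hL24 : (24 : ℝ) ≤ L := by nlinarith [(L.cast_nonneg : (0 : ℝ) ≤ L)]
  have hL6 : 6 ≤ L := by
    have : (6 : ℝ) ≤ L := by linarith
    exact_mod_cast this
  have hK1 : 1 ≤ K := by
    rcases Nat.eq_zero_or_pos K with rfl | h
    · norm_num at hK
    · exact h
  have hKr : (1 : ℝ) ≤ K := by exact_mod_cast hK1
  -- The numbers of triangles of different kinds of inputs are multiples of `r * h`, where
  -- `h = ⌊d / (2 * L * K)⌋`, and twice the error is below `r * h`. The choice of `c` makes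
  -- `(S + q) ^ 2` at most the size `K * h` of the matching.
  refine ⟨1 / (16 * L * K), by positivity, 1 / (4 * L), by positivity,
    (4 * L * q) ^ 2 + 2 * L * K, ?_⟩
  rintro ε hε0 hε r hr d hd W ⟨f⟩
  suffices hS : ∀ (S : ℕ) (A : StreamingAlgorithm W S), A.Solves (hubsGraph r d) ε δ →
      1 / (4 * L) * Real.sqrt d ≤ S by
    have hne : {m : ℕ∞ | ∃ (S : ℕ) (A : StreamingAlgorithm W S),
        A.Solves (hubsGraph r d) ε δ ∧ m = S}.Nonempty ∨ {m : ℕ∞ | ∃ (S : ℕ)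
        (A : StreamingAlgorithm W S), A.Solves (hubsGraph r d) ε δ ∧ m = S} = ∅ :=
      (Set.eq_empty_or_nonempty _).symm
    rw [instOpt]
    rcases hne with hne | hemp
    · obtain ⟨S, A, hA, hm⟩ := csInf_mem hne
      rw [hm, ENat.toENNReal_coe, ← ENNReal.ofReal_natCast]
      exact ENNReal.ofReal_le_ofReal (hS S A hA)
    · rw [hemp, sInf_empty, ENat.toENNReal_top]
      exact le_top
  intro S A hA
  by_contra! hlt
  have hdL : 2 * L * K ≤ d := le_trans (Nat.le_add_left _ _) hd
  have hLK : 0 < 2 * L * K := by positivity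
  set h := d / (2 * L * K) with hh
  have hh1 : 1 ≤ h := (Nat.one_le_div_iff hLK).mpr hdL
  have hh2 : 2 * L * (K * h) ≤ d := by
    have := Nat.div_mul_le_self d (2 * L * K)
    rw [← hh] at this
    linarith
  have hh3 : (d : ℝ) ≤ 4 * L * (K * h) := by
    have h1 : d < 2 * L * K * h + 2 * L * K := by
      have := Nat.lt_div_mul_add (a := d) hLK
      rw [← hh] at this
      linarith
    have h2 : d ≤ 4 * L * (K * h) := by nlinarith
    exact_mod_cast h2
  have hd1 : (1 : ℝ) ≤ d := by
    have : 1 ≤ d := le_trans hLK hdL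
    exact_mod_cast this
  have hεh : 2 * ε * d < h := by
    have h1 : 2 * ε * d ≤ 2 * (1 / (16 * L * K)) * (4 * L * (K * h)) := by gcongr
    have h2 : 2 * (1 / (16 * L * K)) * (4 * L * (K * h)) = (h : ℝ) / 2 := by
      field_simp
      norm_num
    have h3 : (1 : ℝ) ≤ h := by exact_mod_cast hh1
    linarith
  have hD : (S + q) ^ 2 ≤ K * h := by
    have hq' : (q : ℝ) ≤ 1 / (4 * L) * Real.sqrt d := by
      have h1 : ((4 * L * q : ℕ) : ℝ) ≤ Real.sqrt d := by
        refine Real.le_sqrt_of_sq_le ?_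
        exact_mod_cast le_trans (Nat.le_add_right _ _) hd
      rw [one_div, ← div_eq_inv_mul, le_div_iff₀ (by positivity)]
      push_cast at h1
      linarith
    have h2 : ((S : ℝ) + q) ^ 2 ≤ (2 * (1 / (4 * L) * Real.sqrt d)) ^ 2 :=
      pow_le_pow_left₀ (by positivity) (by linarith) 2
    have h3 : (2 * (1 / (4 * L) * Real.sqrt d)) ^ 2 = d / (4 * L ^ 2) := by
      rw [mul_pow, mul_pow, Real.sq_sqrt (by positivity)]
      field_simp
      norm_num
    have h4 : (d : ℝ) / (4 * L ^ 2) ≤ K * h := by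
      rw [div_le_iff₀ (by positivity)]
      refine hh3.trans ?_
      have : (0 : ℝ) ≤ K * h := by positivity
      nlinarith
    have h5 : ((S : ℝ) + q) ^ 2 ≤ K * h := by linarith
    exact_mod_cast h5
  have hfin := hA.mul_one_sub_le hε0.le hr f hL6 (Nat.mul_pos hK1 hh1) hh2 hD hεh
  have h1 : (6 : ℝ) / L ≤ β / 4 := by
    rw [div_le_div_iff₀ (by positivity) (by norm_num)]
    linarith
  have h2 : (2 : ℝ) * 2 ^ S / 2 ^ (S + q) ≤ β / 4 := by
    rw [pow_add, div_le_div_iff₀ (by positivity) (by norm_num)]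
    have : (0 : ℝ) < 2 ^ S := by positivity
    nlinarith
  have h3 : (K : ℝ) * (6 / L + 2 * 2 ^ S / 2 ^ (S + q)) ≤ K * (β / 4 + β / 4) := by gcongr
  rw [← hβ] at hfin
  linarith
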